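/- For $k\in\mathbb N_0$ let $H_k(x)=\frac{(-1)^k}{\sqrt{k!}}e^{x^2/2}\frac{d^k}{dx^k}e^{-x^2/2}$ be the normalized Hermite polynomials, and for $\mathbf k\in\mathbb N_0^d$, $\mathbf x\in\mathbb R^d$ let $H_{\mathbf k}(\mathbf x)=\prod_{j=1}^d H_{k_j}(x_j)$. Let $\varphi_d(\mathbf x)=(2\pi)^{-d/2}e^{-\mathbf x^\top\mathbf x/2}$ and, for measurable $f:\mathbb R^d\to\mathbb R$ with $\int_{\mathbb R^d} f^2\varphi_d\,d\mathbf x<\infty$, let $\hat f(\mathbf k)=\int_{\mathbb R^d} f(\mathbf x)H_{\mathbf k}(\mathbf x)\varphi_d(\mathbf x)\,d\mathbf x$. For a summable function $r:\mathbb N_0^d\to(0,\infty)$ put $\|f\|_r=\big(\sum_{\mathbf k\in\mathbb N_0^d} r(\mathbf k)^{-1}|\hat f(\mathbf k)|^2\big)^{1/2}$, and let the Hermite space $\mathcal H_r$ be the set of all continuous $f:\mathbb R^d\to\mathbb R$ with $\int_{\mathbb R^d} f^2\varphi_d\,d\mathbf x<\infty$ and $\|f\|_r<\infty$. For points $\mathbf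 x_1,\dots,\mathbf x_n\in\mathbb R^d$ ($n\ge1$, repetitions allowed), $\mathcal P=\{\mathbf x_1,\dots,\mathbf x_n\}$, the worst-case error of the QMC rule $\frac1n\sum_{i=1}^n f(\mathbf x_i)$ in $\mathcal H_r$ is $$e_{n,d}(\mathcal P,\mathcal H_r)=\sup_{f\in\mathcal H_r,\ \|f\|_r\le1}\Big|\int_{\mathbb R^d} f(\mathbf x)\varphi_d(\mathbf x)\,d\mathbf x-\frac1n\sum_{i=1}^n f(\mathbf x_i)\Big| .$$ Let $\gamma=(\gamma_1,\dots,\gamma_d)\in(0,1)^d$ and $\omega=(\omega_1,\dots,\omega_d)\in(0,1)^d$, and let $\varepsilon_{\omega,\gamma}(\mathbf k)=\prod_{j=1}^d\varepsilon_{\omega_j,\gamma_j}(k_j)$ with $\varepsilon_{\omega_j,\gamma_j}(0)=1$ and $\varepsilon_{\omega_j,\gamma_j}(k)=\gamma_j\omega_j^{k}$ for $k\ge1$. **Proposition.** For every $n\ge 1$ and all points $\mathbf x_1,\dots,\mathbf x_n\in\mathbb R^d$, $$e_{n,d}(\mathcal P,\mathcal H_{\varepsilon_{\omega,\gamma}})\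 \ge\ \left(\max\left\{0,\ -1+\frac{1}{n}\prod_{j=1}^d\bigl(1+\gamma_j\,c(\omega_j)\bigr)\right\}\right)^{1/2},\qquad c(\omega)=\frac{1-\sqrt{1-\omega^2}}{\sqrt{1-\omega^2}} .$$ -/

import Mathlib

noncomputable section

namespace Hermite

open MeasureTheory
open scoped ENNReal

/-- The density `φ_d` of the standard Gaussian measure on `ℝ^d` with respect to Lebesgue measure. -/
def gaussDensity (d : ℕ) (x : Fin d → ℝ) : ℝ :=
  (2 * Real.pi) ^ (-(d : ℝ) / 2) * Real.exp (-(∑ j, x j ^ 2) / 2)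

/-- The normalized univariate Hermite polynomial
`H_k(x) = (-1)^k / √(k!) · e^{x²/2} · (d/dx)^k e^{-x²/2}`. -/
def hermiteH (k : ℕ) (x : ℝ) : ℝ :=
  (-1) ^ k / Real.sqrt (k.factorial : ℝ) * Real.exp (x ^ 2 / 2) *
    iteratedDeriv k (fun t : ℝ => Real.exp (-(t ^ 2 / 2))) x

/-- `hermiteH k` is Mathlib's (monic, probabilist) Hermite polynomial divided by `√(k!)`. -/
theorem hermiteH_eq (k : ℕ) (x : ℝ) :
    hermiteH k x = Polynomial.aeval x (Polynomial.hermite k) / Real.sqrt (k.factorial : ℝ) := by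
  rw [Polynomial.hermite_eq_deriv_gaussian', hermiteH, iteratedDeriv_eq_iterate]
  ring

/-- The multivariate Hermite polynomial `H_k(x) = ∏_j H_{k_j}(x_j)`. -/
def multiHermite {d : ℕ} (k : Fin d → ℕ) (x : Fin d → ℝ) : ℝ :=
  ∏ j, hermiteH (k j) (x j)

/-- The `k`-th Hermite coefficient of `f`. -/
def hermiteCoeff {d : ℕ} (f : (Fin d → ℝ) → ℝ) (k : Fin d → ℕ) : ℝ :=
  ∫ x, f x * multiHermite k x * gaussDensity d x

/-- Gaussian square-integrable functions on `ℝ^d`. -/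
def GaussSquareIntegrable {d : ℕ} (f : (Fin d → ℝ) → ℝ) : Prop :=
  Measurable f ∧ Integrable (fun x => f x ^ 2 * gaussDensity d x)

/-- The norm `‖f‖_r = (∑_k r(k)⁻¹ |f̂(k)|²)^{1/2}`, with values in `[0, ∞]`. -/
def hermiteNorm {d : ℕ} (r : (Fin d → ℕ) → ℝ) (f : (Fin d → ℝ) → ℝ) : ℝ≥0∞ :=
  (∑' k : Fin d → ℕ, ENNReal.ofReal ((r k)⁻¹ * |hermiteCoeff f k| ^ 2)) ^ (1 / 2 : ℝ)

/-- The Hermite space `H_r` (for `r` positive and summable): the continuous Gaussian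
square-integrable functions with `‖f‖_r < ∞`. -/
def hermiteSpace {d : ℕ} (r : (Fin d → ℕ) → ℝ) : Set ((Fin d → ℝ) → ℝ) :=
  {f | GaussSquareIntegrable f ∧ Continuous f ∧ hermiteNorm r f < ∞}

/-- The integral of `f` against the standard Gaussian measure. -/
def gaussIntegral {d : ℕ} (f : (Fin d → ℝ) → ℝ) : ℝ :=
  ∫ x, f x * gaussDensity d x

/-- The quasi-Monte Carlo rule with nodes `x_1, …, x_n`. -/
def qmcRule {n d : ℕ} (f : (Fin d → ℝ) → ℝ) (x : Fin n → Fin d → ℝ) : ℝ :=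
  1 / (n : ℝ) * ∑ i, f (x i)

/-- The worst case error of the QMC rule with nodes `x` in the Hermite space `H_r`: the supremum
(in `[0, ∞]`) of the integration error over the unit ball of `H_r`. -/
def worstCaseError {n d : ℕ} (x : Fin n → Fin d → ℝ) (r : (Fin d → ℕ) → ℝ) : ℝ≥0∞ :=
  ⨆ f ∈ {f | f ∈ hermiteSpace r ∧ hermiteNorm r f ≤ 1},
    ENNReal.ofReal |gaussIntegral f - qmcRule f x|

/-- The univariate function `ε_{ω,γ}`. -/
def expWeight (ω γ : ℝ) (k : ℕ) : ℝ :=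
  if k = 0 then 1 else γ * ω ^ k

/-- The product function `ε_{ω,γ}(k) = ∏_j ε_{ω_j,γ_j}(k_j)`. -/
def expWeights {d : ℕ} (ω γ : Fin d → ℝ) (k : Fin d → ℕ) : ℝ :=
  ∏ j, expWeight (ω j) (γ j) (k j)

/-- `c(ω) = (1 - √(1 - ω²)) / √(1 - ω²)`. -/
def cOmega (ω : ℝ) : ℝ :=
  (1 - Real.sqrt (1 - ω ^ 2)) / Real.sqrt (1 - ω ^ 2)

end Hermite

end

/-! The squared norm of the error functional is at least -1 + n⁻² ∑_{i,i'} K(x_i, x_i'), where K is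
the product reproducing kernel ∑_k ε(k) H_k(x) H_k(y). Mehler's formula (`hasSum_mehler`) turns each
factor of K into 1 + γ(M(x,y) - 1), with M the Mehler kernel. Since M ≥ 0 and γ < 1, every factor is
nonnegative, so the off-diagonal pairs may be dropped. On the diagonal M(x,x) ≥ 1/√(1-ω²) = 1 +
c(ω), and the n diagonal terms give the bound.

Only the lower estimate of the error is needed. `sqrt_sum_le_worstCaseError` tests with finite
Hermite expansions, and `sqrt_kernel_mean_le_worstCaseError` lets the index box grow.

Mehler's formula rests on He_k(x) = E(x+iZ)^k with Z standard normal: summing ω^k/k! under the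
expectation gives E exp(ω(x+iZ)(y+iW)), a double Gaussian integral. -/

namespace Hermite

open MeasureTheory Polynomial

/-! ### Univariate Gaussian integrals -/

/-- The density of the standard normal distribution. -/
noncomputable def phi (t : ℝ) : ℝ := (2 * Real.pi) ^ (-(1 : ℝ) / 2) * Real.exp (-t ^ 2 / 2)

theorem phi_pos (t : ℝ) : 0 < phi t := by unfold phi; positivity

theorem continuous_phi : Continuous phi := by unfold phi; fun_prop

theorem hasDerivAt_phi (t : ℝ) : HasDerivAt phi (-t * phi t) t := by
  have h : HasDerivAt (fun t : ℝ => -t ^ 2 / 2) (-t) t := by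
    convert! ((hasDerivAt_pow 2 t).neg.div_const 2) using 1
    simp
    ring
  convert! h.exp.const_mul ((2 * Real.pi) ^ (-(1 : ℝ) / 2)) using 1
  unfold phi; ring

theorem gaussDensity_eq_prod {d : ℕ} (x : Fin d → ℝ) : gaussDensity d x = ∏ j, phi (x j) := by
  unfold gaussDensity phi
  rw [Finset.prod_mul_distrib, ← Real.exp_sum, Finset.prod_const, Finset.card_univ,
    Fintype.card_fin, ← Real.rpow_mul_natCast (by positivity)]
  congr 2
  · ring
  · rw [← Finset.sum_div, Finset.sum_neg_distrib]

theorem integral_cexp_mul_phi (c : ℂ) :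
    ∫ z : ℝ, Complex.exp (c * z) * (phi z : ℂ) = Complex.exp (c ^ 2 / 2) := by
  have h : ∀ z : ℝ, Complex.exp (c * z) * (phi z : ℂ)
      = (((2 * Real.pi) ^ (-(1 : ℝ) / 2) : ℝ) : ℂ) *
        Complex.exp ((-1 / 2 : ℂ) * z ^ 2 + c * z + 0) := by
    intro z
    unfold phi
    push_cast
    rw [mul_left_comm, ← Complex.exp_add]
    congr 2
    ring
  simp_rw [h]
  rw [integral_const_mul, integral_cexp_quadratic (by norm_num), ← mul_assoc]
  have h2 : ((Real.pi : ℂ) / -(-1 / 2)) ^ (1 / 2 : ℂ)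
      = (((2 * Real.pi) ^ ((1 : ℝ) / 2) : ℝ) : ℂ) := by
    rw [Complex.ofReal_cpow (by positivity)]
    push_cast
    congr 1
    ring
  rw [h2, ← Complex.ofReal_mul, ← Real.rpow_add (by positivity)]
  norm_num
  ring_nf

theorem integral_phi : ∫ z : ℝ, phi z = 1 := by
  have h := integral_cexp_mul_phi 0
  simp only [zero_mul, Complex.exp_zero, one_mul] at h
  rw [integral_complex_ofReal] at h
  norm_num at h
  exact_mod_cast h

theorem integrable_pow_mul_phi (k : ℕ) : Integrable (fun t : ℝ => t ^ k * phi t) := by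
  have h := (integrable_rpow_mul_exp_neg_mul_sq (b := 1 / 2) (by norm_num) (s := (k : ℝ))
    (by linarith [(Nat.cast_nonneg k : (0 : ℝ) ≤ k)])).const_mul ((2 * Real.pi) ^ (-(1 : ℝ) / 2))
  refine h.congr (Filter.Eventually.of_forall fun t => ?_)
  simp only [Real.rpow_natCast]
  unfold phi
  rw [show -t ^ 2 / 2 = -(1 / 2) * t ^ 2 by ring]
  ring

theorem integrable_complex_eval_mul_phi (p : ℂ[X]) :
    Integrable (fun t : ℝ => p.eval (t : ℂ) * (phi t : ℂ)) := by
  induction p using Polynomial.induction_on' with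
  | add p q hp hq => simpa only [eval_add, add_mul] using! hp.add hq
  | monomial k a =>
    refine ((integrable_pow_mul_phi k).ofReal (𝕜 := ℂ)).const_mul a |>.congr
      (Filter.Eventually.of_forall fun t => ?_)
    simp [eval_monomial, mul_assoc]

theorem integrable_eval_mul_phi (p : ℝ[X]) : Integrable (fun t : ℝ => p.eval t * phi t) := by
  refine (integrable_complex_eval_mul_phi (p.map Complex.ofRealHom)).re.congr
    (Filter.Eventually.of_forall fun t => ?_)
  have : (p.map Complex.ofRealHom).eval (t : ℂ) = ((p.eval t : ℝ) : ℂ)  := by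
    rw [eval_map, ← Complex.ofRealHom_eq_coe, eval₂_at_apply, Complex.ofRealHom_eq_coe]
  simp [this]

/-- Gaussian integration by parts for polynomials. -/
theorem integral_id_mul_complex_eval_mul_phi (p : ℂ[X]) :
    ∫ t : ℝ, (X * p).eval (t : ℂ) * (phi t : ℂ) = ∫ t : ℝ, p.derivative.eval (t : ℂ) * (phi t : ℂ) := by
  have h := integral_eq_zero_of_hasDerivAt_of_integrable
    (f := fun t : ℝ => p.eval (t : ℂ) * (phi t : ℂ))
    (f' := fun t : ℝ => p.derivative.eval (t : ℂ) * (phi t : ℂ) - (X * p).eval (t : ℂ) * (phi t : ℂ))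
    (fun t => by
      have h1 : HasDerivAt (fun t : ℝ => p.eval (t : ℂ)) (p.derivative.eval (t : ℂ)) t :=
        (p.hasDerivAt (t : ℂ)).comp_ofReal
      convert! h1.mul (hasDerivAt_phi t).ofReal_comp using 1
      simp
      ring)
    ((integrable_complex_eval_mul_phi _).sub (integrable_complex_eval_mul_phi _))
    (integrable_complex_eval_mul_phi _)
  rw [integral_sub (integrable_complex_eval_mul_phi _) (integrable_complex_eval_mul_phi _)] at h
  exact (sub_eq_zero.mp h).symm

theorem integral_id_mul_eval_mul_phi (p : ℝ[X]) :
    ∫ t : ℝ, (X * p).eval t * phi t = ∫ t : ℝ, p.derivative.eval t * phi t := by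
  have h := integral_eq_zero_of_hasDerivAt_of_integrable
    (f := fun t : ℝ => p.eval t * phi t)
    (f' := fun t : ℝ => p.derivative.eval t * phi t - (X * p).eval t * phi t)
    (fun t => by
      convert! (p.hasDerivAt t).mul (hasDerivAt_phi t) using 1
      simp
      ring)
    ((integrable_eval_mul_phi _).sub (integrable_eval_mul_phi _))
    (integrable_eval_mul_phi _)
  rw [integral_sub (integrable_eval_mul_phi _) (integrable_eval_mul_phi _)] at h
  exact (sub_eq_zero.mp h).symm

/-! ### Univariate Hermite polynomials: orthogonality and moments -/

/-- The monic Hermite polynomial with real coefficients. -/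
noncomputable def hermiteR (k : ℕ) : ℝ[X] := (hermite k).map (Int.castRingHom ℝ)

theorem hermiteR_zero : hermiteR 0 = 1 := by simp [hermiteR]

theorem hermiteR_succ (k : ℕ) : hermiteR (k + 1) = X * hermiteR k - derivative (hermiteR k) := by
  simp [hermiteR, hermite_succ, derivative_map]

theorem hermiteH_eq_eval (k : ℕ) (x : ℝ) :
    hermiteH k x = (hermiteR k).eval x / Real.sqrt (k.factorial : ℝ) := by
  rw [hermiteH_eq, hermiteR, eval_map, aeval_def]
  rfl

theorem derivative_hermiteR_succ (k : ℕ) :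
    derivative (hermiteR (k + 1)) = (k + 1 : ℝ[X]) * hermiteR k := by
  induction k with
  | zero => simp [hermiteR_succ, hermiteR_zero]
  | succ k ih =>
    rw [hermiteR_succ (k + 1), derivative_sub, derivative_mul, derivative_X, ih, hermiteR_succ k]
    have h : derivative ((k + 1 : ℝ[X]) * hermiteR k) = (k + 1) * derivative (hermiteR k) := by
      rw [derivative_mul]; simp
    rw [h]
    push_cast
    ring

theorem hermiteR_succ_succ (k : ℕ) :
    hermiteR (k + 2) = X * hermiteR (k + 1) - (k + 1 : ℝ[X]) * hermiteR k := by
  rw [hermiteR_succ (k + 1), derivative_hermiteR_succ]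

/-- Under the Gaussian weight, the raising operator `X - d/dt` is adjoint to differentiation.
Iterating this yields orthogonality. -/
theorem integral_mul_hermiteR_succ (p : ℝ[X]) (k : ℕ) :
    ∫ t : ℝ, (p * hermiteR (k + 1)).eval t * phi t
      = ∫ t : ℝ, (derivative p * hermiteR k).eval t * phi t := by
  have h := integral_id_mul_eval_mul_phi (p * hermiteR k)
  have e : ∀ t : ℝ, (p * hermiteR (k + 1)).eval t * phi t =
      (X * (p * hermiteR k)).eval t * phi t - (p * derivative (hermiteR k)).eval t * phi t := by
    intro t; simp [hermiteR_succ]; ring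
  have e' : ∀ t : ℝ, (derivative (p * hermiteR k)).eval t * phi t =
      (derivative p * hermiteR k).eval t * phi t + (p * derivative (hermiteR k)).eval t * phi t := by
    intro t; simp [derivative_mul]; ring
  simp_rw [e]
  rw [integral_sub (integrable_eval_mul_phi _) (integrable_eval_mul_phi _), h]
  simp_rw [e']
  rw [integral_add (integrable_eval_mul_phi _) (integrable_eval_mul_phi _)]
  ring

theorem integral_hermiteR_mul_hermiteR (m k : ℕ) :
    ∫ t : ℝ, (hermiteR m * hermiteR k).eval t * phi t = if m = k then (k.factorial : ℝ) else 0 := by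
  induction k generalizing m with
  | zero =>
    cases m with
    | zero => simp [hermiteR_zero, integral_phi]
    | succ m =>
      rw [mul_comm, integral_mul_hermiteR_succ]
      simp [hermiteR_zero]
  | succ k ih =>
    rw [integral_mul_hermiteR_succ]
    cases m with
    | zero => simp [hermiteR_zero]
    | succ m =>
      have e : ∀ t : ℝ, (derivative (hermiteR (m + 1)) * hermiteR k).eval t * phi t =
          (m + 1 : ℝ) * ((hermiteR m * hermiteR k).eval t * phi t) := by
        intro t; rw [derivative_hermiteR_succ]; simp; ring
      simp_rw [e]
      rw [integral_const_mul, ih]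
      by_cases hm : m = k
      · subst hm; simp [Nat.factorial_succ]
      · simp [hm]

theorem integral_hermiteH_mul_hermiteH (m k : ℕ) :
    ∫ t : ℝ, hermiteH m t * hermiteH k t * phi t = if m = k then 1 else 0 := by
  have e : ∀ t : ℝ, hermiteH m t * hermiteH k t * phi t =
      (Real.sqrt m.factorial * Real.sqrt k.factorial)⁻¹ *
        ((hermiteR m * hermiteR k).eval t * phi t) := by
    intro t; simp only [hermiteH_eq_eval, eval_mul]; field_simp
  simp_rw [e]
  rw [integral_const_mul, integral_hermiteR_mul_hermiteR]
  split_ifs with h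
  · subst h
    rw [Real.mul_self_sqrt (by positivity), inv_mul_cancel₀ (by positivity)]
  · simp

theorem continuous_hermiteH (k : ℕ) : Continuous (hermiteH k) := by
  have : hermiteH k = fun x => (hermiteR k).eval x / Real.sqrt (k.factorial : ℝ) :=
    funext (hermiteH_eq_eval k)
  rw [this]
  fun_prop

theorem integrable_hermiteH_mul_hermiteH (m k : ℕ) :
    Integrable (fun t : ℝ => hermiteH m t * hermiteH k t * phi t) := by
  refine ((integrable_eval_mul_phi (hermiteR m * hermiteR k)).const_mul
    (Real.sqrt m.factorial * Real.sqrt k.factorial)⁻¹).congr (Filter.Eventually.of_forall fun t => ?_)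
  simp only [hermiteH_eq_eval, eval_mul]; field_simp

theorem hermiteH_zero (x : ℝ) : hermiteH 0 x = 1 := by
  simp [hermiteH_eq_eval, hermiteR_zero]

/-- The moment representation of the Hermite polynomials. -/
theorem integral_add_I_mul_pow_mul_phi (k : ℕ) (x : ℝ) :
    ∫ z : ℝ, ((x : ℂ) + Complex.I * z) ^ k * (phi z : ℂ) = (((hermiteR k).eval x : ℝ) : ℂ) := by
  have heval : ∀ (k : ℕ) (z : ℝ), ((x : ℂ) + Complex.I * z) ^ k
      = ((C (x : ℂ) + C Complex.I * X) ^ k).eval (z : ℂ) := by intro k z; simp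
  induction k using Nat.twoStepInduction with
  | zero =>
    simp only [pow_zero, one_mul, hermiteR_zero, eval_one]
    rw [integral_complex_ofReal, integral_phi]
  | one =>
    have h := integral_id_mul_complex_eval_mul_phi 1
    simp only [mul_one, eval_X, derivative_one, eval_zero, zero_mul, integral_zero] at h
    have i1 := integrable_complex_eval_mul_phi X
    have i0 := integrable_complex_eval_mul_phi 1
    simp only [eval_X] at i1
    simp only [eval_one, one_mul] at i0
    simp_rw [pow_one, add_mul, mul_assoc]
    rw [integral_add (i0.const_mul _) (i1.const_mul _), integral_const_mul, integral_const_mul, h,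
      integral_complex_ofReal, integral_phi]
    simp [hermiteR_succ, hermiteR_zero]
  -- Split off one factor x + iz. Integrating its iz part by parts gives i²(k+1) times the k-th
  -- moment, which is the three-term recurrence.
  | more k ih0 ih1 =>
    have h := integral_id_mul_complex_eval_mul_phi ((C (x : ℂ) + C Complex.I * X) ^ (k + 1))
    have e : ∀ z : ℝ, (derivative ((C (x : ℂ) + C Complex.I * X) ^ (k + 1))).eval (z : ℂ) * (phi z : ℂ)
        = ((k + 1 : ℂ) * Complex.I) * (((x : ℂ) + Complex.I * z) ^ k * (phi z : ℂ)) := by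
      intro z; rw [derivative_pow]; simp; ring
    simp_rw [e] at h
    rw [integral_const_mul, ih0] at h
    have e2 : ∀ z : ℝ, ((x : ℂ) + Complex.I * z) ^ (k + 2) * (phi z : ℂ)
        = (x : ℂ) * (((x : ℂ) + Complex.I * z) ^ (k + 1) * (phi z : ℂ))
          + Complex.I * ((X * (C (x : ℂ) + C Complex.I * X) ^ (k + 1)).eval (z : ℂ) * (phi z : ℂ)) := by
      intro z; simp; ring
    have i1 := integrable_complex_eval_mul_phi ((C (x : ℂ) + C Complex.I * X) ^ (k + 1))
    simp_rw [← heval] at i1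
    simp_rw [e2]
    rw [integral_add (i1.const_mul _) ((integrable_complex_eval_mul_phi _).const_mul _),
      integral_const_mul, integral_const_mul, ih1, h, hermiteR_succ_succ]
    simp
    linear_combination (((k : ℂ) + 1) * ((eval x (hermiteR k) : ℝ) : ℂ)) * Complex.I_sq

end Hermite

/-! ### Mehler's formula and the univariate kernel -/

namespace Hermite

open MeasureTheory Polynomial

/-- The Mehler kernel. -/
noncomputable def mehler (ω x y : ℝ) : ℝ :=
  (Real.sqrt (1 - ω ^ 2))⁻¹ *
    Real.exp (ω * x * y - ω ^ 2 * x ^ 2 / 2 - (ω * y - ω ^ 2 * x) ^ 2 / (2 * (1 - ω ^ 2)))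

theorem mehler_nonneg (ω x y : ℝ) : 0 ≤ mehler ω x y := by unfold mehler; positivity

/-- On the diagonal the exponent collapses to ωx²/(1+ω) ≥ 0. -/
theorem le_mehler_self {ω : ℝ} (hω : ω ∈ Set.Ioo (0 : ℝ) 1) (x : ℝ) :
    (Real.sqrt (1 - ω ^ 2))⁻¹ ≤ mehler ω x x := by
  obtain ⟨h0, h1⟩ := hω
  unfold mehler
  refine le_mul_of_one_le_right (by positivity) (Real.one_le_exp ?_)
  have h2 : (1 : ℝ) - ω ^ 2 ≠ 0 := by nlinarith
  have h3 : (1 : ℝ) + ω ≠ 0 := by linarith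
  have : ω * x * x - ω ^ 2 * x ^ 2 / 2 - (ω * x - ω ^ 2 * x) ^ 2 / (2 * (1 - ω ^ 2))
      = ω * x ^ 2 / (1 + ω) := by
    field_simp
    ring
  rw [this]
  positivity

/-- A product Gaussian majorant for the integrand in the double-integral form of Mehler's sum. -/
noncomputable def mehlerBound (ω x z : ℝ) : ℝ :=
  Real.exp (ω / 2 * (|x| + |z|) ^ 2) * phi z

theorem integrable_mehlerBound {ω : ℝ} (hω : ω ∈ Set.Ioo (0 : ℝ) 1) (x : ℝ) :
    Integrable (mehlerBound ω x) := by
  obtain ⟨h0, h1⟩ := hω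
  have hi := (integrable_exp_neg_mul_sq (b := (1 - ω) / 4) (by linarith)).const_mul
    ((2 * Real.pi) ^ (-(1 : ℝ) / 2) * Real.exp (ω * x ^ 2 / 2 + ω ^ 2 * x ^ 2 / (1 - ω)))
  refine hi.mono' ?_ (Filter.Eventually.of_forall fun z => ?_)
  · unfold mehlerBound
    exact (Continuous.mul (by fun_prop) continuous_phi).aestronglyMeasurable
  · unfold mehlerBound phi
    rw [Real.norm_of_nonneg (by positivity), mul_left_comm, mul_assoc, ← Real.exp_add,
      ← Real.exp_add]
    refine mul_le_mul_of_nonneg_left (Real.exp_le_exp.mpr ?_) (by positivity)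
    -- The net decay is (1-ω)z²/2; completing the square spends half of it on the cross term.
    have h2 : ω * |x| * |z| ≤ (1 - ω) / 4 * z ^ 2 + ω ^ 2 * x ^ 2 / (1 - ω) := by
      have h3 : (1 - ω) / 4 * z ^ 2 + ω ^ 2 * x ^ 2 / (1 - ω) - ω * |x| * |z|
          = ((1 - ω) / 2 * |z| - ω * |x|) ^ 2 / (1 - ω) := by
        have : (1 : ℝ) - ω ≠ 0 := by linarith
        rw [← sq_abs z, ← sq_abs x]
        field_simp
        ring
      have : 0 ≤ ((1 - ω) / 2 * |z| - ω * |x|) ^ 2 / (1 - ω) :=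
        div_nonneg (sq_nonneg _) (by linarith)
      linarith
    have := sq_abs z
    have := sq_abs x
    nlinarith

/-- The inequality 2ab ≤ a² + b² separates the two variables. -/
theorem exp_mul_phi_mul_phi_le {ω : ℝ} (hω : 0 ≤ ω) (x y : ℝ) (p : ℝ × ℝ) :
    Real.exp (ω * ((|x| + |p.1|) * (|y| + |p.2|))) * (phi p.1 * phi p.2) ≤
      mehlerBound ω x p.1 * mehlerBound ω y p.2 := by
  unfold mehlerBound
  rw [mul_mul_mul_comm, ← Real.exp_add]
  refine mul_le_mul_of_nonneg_right (Real.exp_le_exp.mpr ?_)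
    (mul_nonneg (phi_pos _).le (phi_pos _).le)
  nlinarith [mul_nonneg hω (sq_nonneg ((|x| + |p.1|) - (|y| + |p.2|)))]

theorem integrable_exp_mul_phi_mul_phi {ω : ℝ} (hω : ω ∈ Set.Ioo (0 : ℝ) 1) (x y : ℝ) :
    Integrable (fun p : ℝ × ℝ =>
      Real.exp (ω * ((|x| + |p.1|) * (|y| + |p.2|))) * (phi p.1 * phi p.2)) := by
  refine ((integrable_mehlerBound hω x).mul_prod (integrable_mehlerBound hω y)).mono' ?_
    (Filter.Eventually.of_forall fun p => ?_)
  · have := continuous_phi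
    exact Continuous.aestronglyMeasurable (by fun_prop)
  · rw [Real.norm_of_nonneg (mul_nonneg (Real.exp_pos _).le
      (mul_nonneg (phi_pos _).le (phi_pos _).le))]
    exact exp_mul_phi_mul_phi_le hω.1.le x y p

theorem norm_add_I_mul_le (x z : ℝ) : ‖(x : ℂ) + Complex.I * z‖ ≤ |x| + |z| := by
  refine (norm_add_le _ _).trans ?_
  simp

theorem norm_mehlerIntegrand_le {ω : ℝ} (hω : 0 ≤ ω) (x y : ℝ) (p : ℝ × ℝ) :
    ‖(ω : ℂ) * (((x : ℂ) + Complex.I * p.1) * ((y : ℂ) + Complex.I * p.2))‖ ≤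
      ω * ((|x| + |p.1|) * (|y| + |p.2|)) := by
  rw [norm_mul, norm_mul, Complex.norm_real, Real.norm_of_nonneg hω]
  gcongr <;> exact norm_add_I_mul_le _ _

theorem integral_mehlerIntegrand {ω : ℝ} (hω : ω ∈ Set.Ioo (0 : ℝ) 1) (x y : ℝ) :
    ∫ p : ℝ × ℝ, Complex.exp (ω * (((x : ℂ) + Complex.I * p.1) * ((y : ℂ) + Complex.I * p.2))) *
      ((phi p.1 : ℂ) * (phi p.2 : ℂ)) = ((mehler ω x y : ℝ) : ℂ) := by
  have hint : Integrable (fun p : ℝ × ℝ =>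
      Complex.exp (ω * (((x : ℂ) + Complex.I * p.1) * ((y : ℂ) + Complex.I * p.2))) *
      ((phi p.1 : ℂ) * (phi p.2 : ℂ))) := by
    refine (integrable_exp_mul_phi_mul_phi hω x y).mono' ?_ (Filter.Eventually.of_forall fun p => ?_)
    · have := continuous_phi
      exact Continuous.aestronglyMeasurable (by fun_prop)
    · rw [norm_mul, norm_mul, Complex.norm_real, Complex.norm_real,
        Real.norm_of_nonneg (phi_pos _).le, Real.norm_of_nonneg (phi_pos _).le]
      refine mul_le_mul_of_nonneg_right ((Complex.norm_exp_le_exp_norm _).trans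
        (Real.exp_le_exp.mpr (norm_mehlerIntegrand_le hω.1.le x y p)))
        (mul_nonneg (phi_pos _).le (phi_pos _).le)
  rw [Measure.volume_eq_prod] at hint ⊢
  rw [integral_prod _ hint]
  obtain ⟨h0, h1⟩ := hω
  have hpos : (0 : ℝ) < 1 - ω ^ 2 := by nlinarith
  -- Integrating out w leaves a Gaussian in z with quadratic coefficient -(1-ω²)/2, the source of
  -- the factor 1/√(1-ω²).
  have hinner : ∀ z : ℝ, ∫ w : ℝ,
      Complex.exp (ω * (((x : ℂ) + Complex.I * z) * ((y : ℂ) + Complex.I * w))) *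
        ((phi z : ℂ) * (phi w : ℂ))
      = (((2 * Real.pi) ^ (-(1 : ℝ) / 2) : ℝ) : ℂ) *
        Complex.exp ((-(((1 - ω ^ 2) / 2 : ℝ) : ℂ)) * z ^ 2 +
          (Complex.I * (ω * y - ω ^ 2 * x)) * z + (ω * x * y - ω ^ 2 * x ^ 2 / 2)) := by
    intro z
    have e : ∀ w : ℝ, Complex.exp (ω * (((x : ℂ) + Complex.I * z) * ((y : ℂ) + Complex.I * w))) *
        ((phi z : ℂ) * (phi w : ℂ))
        = (Complex.exp (ω * ((x : ℂ) + Complex.I * z) * y) * (phi z : ℂ)) *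
          (Complex.exp ((Complex.I * ω * ((x : ℂ) + Complex.I * z)) * w) * (phi w : ℂ)) := by
      intro w
      rw [mul_mul_mul_comm, ← Complex.exp_add]
      congr 2
      ring
    simp_rw [e]
    rw [integral_const_mul, integral_cexp_mul_phi]
    unfold phi
    push_cast
    rw [mul_left_comm, mul_assoc, ← Complex.exp_add, ← Complex.exp_add]
    congr 2
    linear_combination (ω ^ 2 * (x + Complex.I * z) ^ 2 / 2
      - ω ^ 2 * z ^ 2 / 2 : ℂ) * Complex.I_sq
  simp_rw [hinner]
  rw [integral_const_mul, integral_cexp_quadratic (by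
    rw [Complex.neg_re, Complex.ofReal_re]; linarith), neg_neg, ← mul_assoc]
  have h2 : ((Real.pi : ℂ) / (((1 - ω ^ 2) / 2 : ℝ) : ℂ)) ^ (1 / 2 : ℂ)
      = ((((2 * Real.pi) ^ ((1 : ℝ) / 2) * (Real.sqrt (1 - ω ^ 2))⁻¹ : ℝ)) : ℂ) := by
    rw [Real.sqrt_eq_rpow, ← Real.inv_rpow hpos.le, ← Real.mul_rpow (by positivity) (by positivity),
      Complex.ofReal_cpow (by positivity)]
    push_cast
    congr 1
    field_simp
  rw [h2, ← Complex.ofReal_mul, ← mul_assoc, ← Real.rpow_add (by positivity)]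
  unfold mehler
  have hne : (1 : ℂ) - ω ^ 2 ≠ 0 := by exact_mod_cast hpos.ne'
  push_cast
  congr 1
  · norm_num
  · congr 1
    field_simp
    linear_combination (4 * ((ω : ℂ) * y - ω ^ 2 * x) ^ 2 : ℂ) * Complex.I_sq

/-- **Mehler's formula**. -/
theorem hasSum_mehler {ω : ℝ} (hω : ω ∈ Set.Ioo (0 : ℝ) 1) (x y : ℝ) :
    HasSum (fun k : ℕ => ω ^ k * (hermiteH k x * hermiteH k y)) (mehler ω x y) := by
  have key := hasSum_integral_of_dominated_convergence (μ := (volume : Measure (ℝ × ℝ)))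
    (F := fun (k : ℕ) (p : ℝ × ℝ) =>
      ((ω : ℂ) * (((x : ℂ) + Complex.I * p.1) * ((y : ℂ) + Complex.I * p.2))) ^ k / (k.factorial : ℂ) *
        ((phi p.1 : ℂ) * (phi p.2 : ℂ)))
    (f := fun p => Complex.exp (ω * (((x : ℂ) + Complex.I * p.1) * ((y : ℂ) + Complex.I * p.2))) *
      ((phi p.1 : ℂ) * (phi p.2 : ℂ)))
    -- The majorants sum to a real exponential, integrable against the Gaussians because ω < 1.
    (fun (k : ℕ) (p : ℝ × ℝ) => (ω * ((|x| + |p.1|) * (|y| + |p.2|))) ^ k / (k.factorial : ℝ) *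
      (phi p.1 * phi p.2))
    (fun k => by
      have := continuous_phi
      exact Continuous.aestronglyMeasurable (by fun_prop))
    (fun k => Filter.Eventually.of_forall fun p => by
      rw [norm_mul, norm_mul, Complex.norm_real, Complex.norm_real,
        Real.norm_of_nonneg (phi_pos _).le, Real.norm_of_nonneg (phi_pos _).le, norm_div, norm_pow,
        Complex.norm_natCast]
      refine mul_le_mul_of_nonneg_right ?_ (mul_nonneg (phi_pos _).le (phi_pos _).le)
      gcongr
      exact norm_mehlerIntegrand_le hω.1.le x y p)
    (Filter.Eventually.of_forall fun p => (Real.summable_pow_div_factorial _).mul_right _)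
    (by
      refine (integrable_exp_mul_phi_mul_phi hω x y).congr (Filter.Eventually.of_forall fun p => ?_)
      simp only
      rw [tsum_mul_right, Real.exp_eq_exp_ℝ, NormedSpace.exp_eq_tsum_div])
    (Filter.Eventually.of_forall fun p => by
      refine HasSum.mul_right _ ?_
      rw [Complex.exp_eq_exp_ℂ]
      exact NormedSpace.expSeries_div_hasSum_exp _)
  rw [integral_mehlerIntegrand hω] at key
  rw [← Complex.hasSum_ofReal]
  convert! key using 2 with k
  have e : ∀ p : ℝ × ℝ,
      ((ω : ℂ) * (((x : ℂ) + Complex.I * p.1) * ((y : ℂ) + Complex.I * p.2))) ^ k / (k.factorial : ℂ) *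
        ((phi p.1 : ℂ) * (phi p.2 : ℂ)) = ((ω : ℂ) ^ k / (k.factorial : ℂ)) *
        ((((x : ℂ) + Complex.I * p.1) ^ k * (phi p.1 : ℂ)) *
          (((y : ℂ) + Complex.I * p.2) ^ k * (phi p.2 : ℂ))) := by
    intro p; rw [mul_pow, mul_pow]; ring
  simp_rw [e]
  rw [integral_const_mul, Measure.volume_eq_prod,
    integral_prod_mul (fun z : ℝ => ((x : ℂ) + Complex.I * z) ^ k * (phi z : ℂ))
      (fun z : ℝ => ((y : ℂ) + Complex.I * z) ^ k * (phi z : ℂ)),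
    integral_add_I_mul_pow_mul_phi, integral_add_I_mul_pow_mul_phi]
  rw [hermiteH_eq_eval, hermiteH_eq_eval, div_mul_div_comm, Real.mul_self_sqrt (by positivity)]
  push_cast
  ring

/-- The reproducing kernel of the univariate space, in closed form. -/
theorem hasSum_expWeight {ω : ℝ} (hω : ω ∈ Set.Ioo (0 : ℝ) 1) (γ x y : ℝ) :
    HasSum (fun k : ℕ => expWeight ω γ k * (hermiteH k x * hermiteH k y))
      (1 + γ * (mehler ω x y - 1)) := by
  have h1 := (hasSum_mehler hω x y).mul_left γ
  -- Scaling Mehler's series by γ leaves γ at k = 0, where the weight is 1; this adds the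
  -- difference.
  have h2 := hasSum_ite_eq (0 : ℕ) (1 - γ)
  convert! h1.add h2 using 1
  · ext k
    by_cases hk : k = 0
    · subst hk; simp [expWeight, hermiteH_zero]
    · simp [expWeight, hk]; ring
  · ring

theorem one_add_mul_cOmega_le {ω γ : ℝ} (hω : ω ∈ Set.Ioo (0 : ℝ) 1) (hγ : 0 ≤ γ) (x : ℝ) :
    1 + γ * cOmega ω ≤ 1 + γ * (mehler ω x x - 1) := by
  have hpos : (0 : ℝ) < 1 - ω ^ 2 := by nlinarith [hω.1, hω.2]
  have h : cOmega ω = (Real.sqrt (1 - ω ^ 2))⁻¹ - 1 := by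
    have := (Real.sqrt_pos.mpr hpos).ne'
    unfold cOmega
    field_simp
  have := le_mehler_self hω x
  rw [h]
  gcongr

theorem cOmega_nonneg (ω : ℝ) : 0 ≤ cOmega ω :=
  div_nonneg (sub_nonneg.mpr (Real.sqrt_le_one.mpr (by nlinarith [sq_nonneg ω])))
    (Real.sqrt_nonneg _)

end Hermite

/-! ### Multivariate expansions and the worst-case error -/

namespace Hermite

open MeasureTheory
open scoped ENNReal

variable {d : ℕ}

theorem multiHermite_zero (x : Fin d → ℝ) : multiHermite (0 : Fin d → ℕ) x = 1 := by
  simp [multiHermite, hermiteH_zero]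

theorem continuous_multiHermite (k : Fin d → ℕ) : Continuous (multiHermite k) := by
  unfold multiHermite
  exact continuous_finsetProd _ fun j _ => (continuous_hermiteH _).comp (continuous_apply j)

theorem multiHermite_mul_mul_gaussDensity (m k : Fin d → ℕ) (x : Fin d → ℝ) :
    multiHermite m x * multiHermite k x * gaussDensity d x =
      ∏ j, hermiteH (m j) (x j) * hermiteH (k j) (x j) * phi (x j) := by
  simp only [multiHermite, gaussDensity_eq_prod, Finset.prod_mul_distrib]

theorem integrable_multiHermite_mul (m k : Fin d → ℕ) :
    Integrable (fun x => multiHermite m x * multiHermite k x * gaussDensity d x) := by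
  simp_rw [multiHermite_mul_mul_gaussDensity]
  exact Integrable.fintype_prod
    (f := fun j (t : ℝ) => hermiteH (m j) t * hermiteH (k j) t * phi t)
    (fun j => integrable_hermiteH_mul_hermiteH _ _)

theorem integral_multiHermite_mul (m k : Fin d → ℕ) :
    ∫ x, multiHermite m x * multiHermite k x * gaussDensity d x = if m = k then 1 else 0 := by
  simp_rw [multiHermite_mul_mul_gaussDensity]
  rw [integral_fintype_prod_volume_eq_prod
    (fun j (t : ℝ) => hermiteH (m j) t * hermiteH (k j) t * phi t)]
  simp_rw [integral_hermiteH_mul_hermiteH]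
  rw [Fintype.prod_ite_zero]
  simp [funext_iff]

/-- The finite Hermite expansion with coefficients `a` on `B`. -/
noncomputable def hermiteSum (B : Finset (Fin d → ℕ)) (a : (Fin d → ℕ) → ℝ) (x : Fin d → ℝ) : ℝ :=
  ∑ k ∈ B, a k * multiHermite k x

theorem continuous_hermiteSum (B : Finset (Fin d → ℕ)) (a : (Fin d → ℕ) → ℝ) :
    Continuous (hermiteSum B a) :=
  continuous_finsetSum _ fun k _ => continuous_const.mul (continuous_multiHermite k)

theorem hermiteCoeff_hermiteSum (B : Finset (Fin d → ℕ)) (a : (Fin d → ℕ) → ℝ) (k : Fin d → ℕ) :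
    hermiteCoeff (hermiteSum B a) k = if k ∈ B then a k else 0 := by
  unfold hermiteCoeff hermiteSum
  simp_rw [Finset.sum_mul, mul_assoc]
  simp_rw [← mul_assoc (multiHermite _ _)]
  rw [integral_finsetSum _ fun m _ => (integrable_multiHermite_mul m k).const_mul (a m)]
  simp_rw [integral_const_mul, integral_multiHermite_mul]
  simp

theorem gaussSquareIntegrable_hermiteSum (B : Finset (Fin d → ℕ)) (a : (Fin d → ℕ) → ℝ) :
    GaussSquareIntegrable (hermiteSum B a) := by
  refine ⟨(continuous_hermiteSum B a).measurable, ?_⟩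
  have h : Integrable (fun x => ∑ m ∈ B, ∑ k ∈ B, (a m * a k) *
      (multiHermite m x * multiHermite k x * gaussDensity d x)) :=
    integrable_finsetSum _ fun m _ => integrable_finsetSum _ fun k _ =>
      (integrable_multiHermite_mul m k).const_mul _
  refine h.congr (Filter.Eventually.of_forall fun x => ?_)
  simp only [hermiteSum]
  rw [sq, Finset.sum_mul_sum, Finset.sum_mul]
  refine Finset.sum_congr rfl fun m _ => ?_
  rw [Finset.sum_mul]
  exact Finset.sum_congr rfl fun k _ => by ring

theorem hermiteNorm_hermiteSum {r : (Fin d → ℕ) → ℝ} (hr : ∀ k, 0 < r k)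
    (B : Finset (Fin d → ℕ)) (a : (Fin d → ℕ) → ℝ) :
    hermiteNorm r (hermiteSum B a) =
      ENNReal.ofReal (∑ k ∈ B, (r k)⁻¹ * a k ^ 2) ^ (1 / 2 : ℝ) := by
  unfold hermiteNorm
  simp_rw [hermiteCoeff_hermiteSum, sq_abs]
  rw [tsum_eq_sum (s := B) fun k hk => by simp [hk], ENNReal.ofReal_sum_of_nonneg fun k _ =>
    mul_nonneg (inv_nonneg.mpr (hr k).le) (sq_nonneg _)]
  congr 1
  exact Finset.sum_congr rfl fun k hk => by simp [hk]

theorem gaussIntegral_eq_hermiteCoeff (f : (Fin d → ℝ) → ℝ) :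
    gaussIntegral f = hermiteCoeff f 0 := by
  simp [gaussIntegral, hermiteCoeff, multiHermite_zero]

theorem qmcRule_hermiteSum {n : ℕ} (x : Fin n → Fin d → ℝ) (B : Finset (Fin d → ℕ))
    (a : (Fin d → ℕ) → ℝ) :
    qmcRule (hermiteSum B a) x = ∑ k ∈ B, a k * qmcRule (multiHermite k) x := by
  unfold qmcRule hermiteSum
  rw [Finset.sum_comm, Finset.mul_sum]
  refine Finset.sum_congr rfl fun k _ => ?_
  rw [← Finset.mul_sum]
  ring

/-- The worst-case error is at least the norm of the error functional on any finite-dimensional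
space of Hermite expansions without constant term. -/
theorem sqrt_sum_le_worstCaseError {n : ℕ} (x : Fin n → Fin d → ℝ) {r : (Fin d → ℕ) → ℝ}
    (hr : ∀ k, 0 < r k) (B : Finset (Fin d → ℕ)) (hB : 0 ∉ B) :
    ENNReal.ofReal (Real.sqrt (∑ k ∈ B, r k * qmcRule (multiHermite k) x ^ 2)) ≤
      worstCaseError x r := by
  set A := ∑ k ∈ B, r k * qmcRule (multiHermite k) x ^ 2 with hA
  have hA0 : 0 ≤ A := Finset.sum_nonneg fun k _ => mul_nonneg (hr k).le (sq_nonneg _)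
  rcases hA0.eq_or_lt with h0 | hpos
  · simp [← h0]
  have hs : 0 < Real.sqrt A := Real.sqrt_pos.mpr hpos
  -- Equality case of Cauchy–Schwarz: the normalized Riesz representer of the QMC functional on the
  -- span of `B`.
  set a : (Fin d → ℕ) → ℝ := fun k => r k * qmcRule (multiHermite k) x / Real.sqrt A with ha
  have hnorm : hermiteNorm r (hermiteSum B a) = 1 := by
    have : ∑ k ∈ B, (r k)⁻¹ * a k ^ 2 = 1 := by
      have e : ∀ k ∈ B, (r k)⁻¹ * a k ^ 2 = r k * qmcRule (multiHermite k) x ^ 2 / A := by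
        intro k _
        have := (hr k).ne'
        rw [ha]
        simp only [div_pow, Real.sq_sqrt hA0]
        field_simp
      rw [Finset.sum_congr rfl e, ← Finset.sum_div, ← hA, div_self hpos.ne']
    rw [hermiteNorm_hermiteSum hr, this]
    simp
  have hq : qmcRule (hermiteSum B a) x = Real.sqrt A := by
    have e : ∀ k ∈ B, a k * qmcRule (multiHermite k) x =
        r k * qmcRule (multiHermite k) x ^ 2 / Real.sqrt A := by
      intro k _; rw [ha]; ring
    rw [qmcRule_hermiteSum, Finset.sum_congr rfl e, ← Finset.sum_div, ← hA, Real.div_sqrt]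
  have herr : |gaussIntegral (hermiteSum B a) - qmcRule (hermiteSum B a) x| = Real.sqrt A := by
    rw [gaussIntegral_eq_hermiteCoeff, hermiteCoeff_hermiteSum, if_neg hB, hq, zero_sub, abs_neg,
      abs_of_pos hs]
  rw [← herr]
  exact le_iSup₂_of_le (f := fun f (_ : f ∈ {f | f ∈ hermiteSpace r ∧ hermiteNorm r f ≤ 1}) =>
      ENNReal.ofReal |gaussIntegral f - qmcRule f x|) (hermiteSum B a)
    ⟨⟨gaussSquareIntegrable_hermiteSum B a, continuous_hermiteSum B a, by rw [hnorm]; simp⟩, hnorm.le⟩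
    le_rfl

theorem expWeight_pos {ω γ : ℝ} (hω : 0 < ω) (hγ : 0 < γ) (k : ℕ) : 0 < expWeight ω γ k := by
  unfold expWeight
  split_ifs <;> positivity

/-- The truncated kernel sum factorizes over the coordinates. -/
theorem sum_box_expWeights {n : ℕ} (ω γ : Fin d → ℝ) (x : Fin n → Fin d → ℝ) (N : ℕ) :
    ∑ k ∈ Fintype.piFinset (fun _ : Fin d => Finset.range N),
        expWeights ω γ k * qmcRule (multiHermite k) x ^ 2 =
      (1 / (n : ℝ)) ^ 2 * ∑ i, ∑ i', ∏ j, ∑ k ∈ Finset.range N,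
        expWeight (ω j) (γ j) k * (hermiteH k (x i j) * hermiteH k (x i' j)) := by
  have e : ∀ k : Fin d → ℕ, expWeights ω γ k * qmcRule (multiHermite k) x ^ 2 =
      (1 / (n : ℝ)) ^ 2 * ∑ i, ∑ i', ∏ j,
        expWeight (ω j) (γ j) (k j) * (hermiteH (k j) (x i j) * hermiteH (k j) (x i' j)) := by
    intro k
    simp only [qmcRule, expWeights, multiHermite, Finset.prod_mul_distrib, ← Finset.mul_sum]
    rw [← Finset.sum_mul]
    ring
  simp_rw [e, ← Finset.mul_sum]
  congr 1
  rw [Finset.sum_comm]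
  refine Finset.sum_congr rfl fun i _ => ?_
  rw [Finset.sum_comm]
  refine Finset.sum_congr rfl fun i' _ => ?_
  rw [Finset.prod_univ_sum]

theorem prod_div_le_kernel_mean {n : ℕ} (hn : 0 < n) {ω γ : Fin d → ℝ}
    (hγ : ∀ j, γ j ∈ Set.Ioo (0 : ℝ) 1) (hω : ∀ j, ω j ∈ Set.Ioo (0 : ℝ) 1)
    (x : Fin n → Fin d → ℝ) :
    (∏ j, (1 + γ j * cOmega (ω j))) / (n : ℝ) ≤
      (1 / (n : ℝ)) ^ 2 * ∑ i, ∑ i', ∏ j, (1 + γ j * (mehler (ω j) (x i j) (x i' j) - 1)) := by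
  have hn' : (0 : ℝ) < n := by exact_mod_cast hn
  -- The factor equals (1-γ) + γM.
  have hfac : ∀ j s t, 0 ≤ 1 + γ j * (mehler (ω j) s t - 1) := fun j s t => by
    nlinarith [(hγ j).1, (hγ j).2, mul_nonneg (hγ j).1.le (mehler_nonneg (ω j) s t)]
  have h : (n : ℝ) * ∏ j, (1 + γ j * cOmega (ω j)) ≤
      ∑ i, ∑ i', ∏ j, (1 + γ j * (mehler (ω j) (x i j) (x i' j) - 1)) := by
    have : (n : ℝ) * ∏ j, (1 + γ j * cOmega (ω j)) =
        ∑ _i : Fin n, ∏ j, (1 + γ j * cOmega (ω j)) := by simp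
    rw [this]
    refine Finset.sum_le_sum fun i _ => ?_
    refine le_trans ?_ (Finset.single_le_sum
      (f := fun i' => ∏ j, (1 + γ j * (mehler (ω j) (x i j) (x i' j) - 1)))
      (fun i' _ => Finset.prod_nonneg fun j _ => hfac j _ _) (Finset.mem_univ i))
    exact Finset.prod_le_prod
      (fun j _ => add_nonneg zero_le_one (mul_nonneg (hγ j).1.le (cOmega_nonneg _)))
      fun j _ => one_add_mul_cOmega_le (hω j) (hγ j).1.le _
  calc (∏ j, (1 + γ j * cOmega (ω j))) / (n : ℝ)
      = (1 / (n : ℝ)) ^ 2 * ((n : ℝ) * ∏ j, (1 + γ j * cOmega (ω j))) := by field_simp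
    _ ≤ _ := mul_le_mul_of_nonneg_left h (by positivity)

theorem sqrt_kernel_mean_le_worstCaseError {n : ℕ} (hn : 0 < n) {ω γ : Fin d → ℝ}
    (hγ : ∀ j, γ j ∈ Set.Ioo (0 : ℝ) 1) (hω : ∀ j, ω j ∈ Set.Ioo (0 : ℝ) 1)
    (x : Fin n → Fin d → ℝ) :
    ENNReal.ofReal (Real.sqrt (-1 + (1 / (n : ℝ)) ^ 2 *
        ∑ i, ∑ i', ∏ j, (1 + γ j * (mehler (ω j) (x i j) (x i' j) - 1)))) ≤
      worstCaseError x (expWeights ω γ) := by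
  have hlim : Filter.Tendsto (fun N : ℕ => ENNReal.ofReal (Real.sqrt (-1 + (1 / (n : ℝ)) ^ 2 *
      ∑ i, ∑ i', ∏ j, ∑ k ∈ Finset.range N,
        expWeight (ω j) (γ j) k * (hermiteH k (x i j) * hermiteH k (x i' j))))) Filter.atTop
      (nhds (ENNReal.ofReal (Real.sqrt (-1 + (1 / (n : ℝ)) ^ 2 *
        ∑ i, ∑ i', ∏ j, (1 + γ j * (mehler (ω j) (x i j) (x i' j) - 1)))))) := by
    refine ENNReal.tendsto_ofReal (Filter.Tendsto.sqrt (tendsto_const_nhds.add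
      (tendsto_const_nhds.mul ?_)))
    exact tendsto_finsetSum _ fun i _ => tendsto_finsetSum _ fun i' _ =>
      tendsto_finsetProd _ fun j _ => (hasSum_expWeight (hω j) (γ j) _ _).tendsto_sum_nat
  refine le_of_tendsto hlim (Filter.eventually_atTop.mpr ⟨1, fun N hN => ?_⟩)
  have hr : ∀ k, 0 < expWeights ω γ k := fun k =>
    Finset.prod_pos fun j _ => expWeight_pos (hω j).1 (hγ j).1 _
  have h0 : (0 : Fin d → ℕ) ∈ Fintype.piFinset (fun _ : Fin d => Finset.range N) := by
    simp [Fintype.mem_piFinset]; omega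
  have hmain := sqrt_sum_le_worstCaseError x hr
    ((Fintype.piFinset (fun _ : Fin d => Finset.range N)).erase 0) (Finset.notMem_erase _ _)
  have hsum := Finset.add_sum_erase _
    (fun k => expWeights ω γ k * qmcRule (multiHermite k) x ^ 2) h0
  -- The QMC rule is exact on constants, so the removed index 0 accounts exactly for the -1.
  have hzero : expWeights ω γ (0 : Fin d → ℕ) * qmcRule (multiHermite 0) x ^ 2 = 1 := by
    have : (n : ℝ) ≠ 0 := by exact_mod_cast hn.ne'
    simp [expWeights, expWeight, qmcRule, multiHermite_zero, this]
  rw [sum_box_expWeights, hzero] at hsum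
  rwa [← hsum, neg_add_cancel_left]

end Hermite

theorem mainTheorem5 (d n : ℕ) (hn : 0 < n) (γ ω : Fin d → ℝ)
    (hγ : ∀ j, γ j ∈ Set.Ioo (0 : ℝ) 1) (hω : ∀ j, ω j ∈ Set.Ioo (0 : ℝ) 1)
    (x : Fin n → Fin d → ℝ) :
    ENNReal.ofReal
        (Real.sqrt (max 0 (-1 + (∏ j, (1 + γ j * Hermite.cOmega (ω j))) / (n : ℝ)))) ≤
      Hermite.worstCaseError x (Hermite.expWeights ω γ) := by
  refine le_trans ?_ (Hermite.sqrt_kernel_mean_le_worstCaseError hn hγ hω x)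
  have h := Hermite.prod_div_le_kernel_mean hn hγ hω x
  rcases max_cases 0 (-1 + (∏ j, (1 + γ j * Hermite.cOmega (ω j))) / (n : ℝ)) with ⟨e, _⟩ | ⟨e, _⟩
  · simp [e]
  · rw [e]
    gcongr
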